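/- Let $m,n,r,k$ be non-negative integers with $r\le\min(m,n)$ and $k>(m+n-r)r$, let $\varepsilon>0$, and let $\mathbf X$ be a random matrix in $\mathbb R^{m\times n}$, of arbitrary distribution, with $\operatorname{rank}(\mathbf X)\le r$ almost surely. Write $\langle A,B\rangle=\operatorname{tr}(A^{\mathsf T}B)$. For measurement matrices $A_1,\dots,A_k\in\mathbb R^{m\times n}$, a decoder achieving error probability $\varepsilon$ is a measurable map $g:\mathbb R^k\to\mathbb R^{m\times n}$ such that $$\Pr\big[g\big((\langle A_1,\mathbf X\rangle,\dots,\langle A_k,\mathbf X\rangle)^{\mathsf T}\big)\neq\mathbf X\big]\le\varepsilon .$$ Then: 1. for Lebesgue-almost all $(A_1,\dots,A_k)\in(\mathbb R^{m\times n})^k$ there exists a decoder achieving error probability $\varepsilon$; 2. for Lebesgue-almost all $(a_1,\dots,a_k,b_1,\dots,b_k)\in(\mathbb R^m)^k\times(\mathbb R^n)^k$ there exists a decoder achieving error probability $\varepsilon$ for the rank-one measurement matrices $A_i=a_ib_i^{\mathsf T}$, $i=1,\dots,k$. -/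

import Mathlib

open MeasureTheory

namespace MatrixCompletion

/-- Lebesgue measure on `ℝ^{m × n}` (together with the Borel σ-algebra), as the product of the
Lebesgue measures of the `m n` entries. -/
noncomputable instance matrixMeasureSpace (m n : ℕ) : MeasureSpace (Matrix (Fin m) (Fin n) ℝ) :=
  inferInstanceAs (MeasureSpace (Fin m → Fin n → ℝ))

instance matrixBorelSpace (m n : ℕ) : BorelSpace (Matrix (Fin m) (Fin n) ℝ) :=
  inferInstanceAs (BorelSpace (Fin m → Fin n → ℝ))

instance matrixSigmaFinite (m n : ℕ) :
    SigmaFinite (volume : Measure (Matrix (Fin m) (Fin n) ℝ)) :=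
  inferInstanceAs (SigmaFinite (volume : Measure (Fin m → Fin n → ℝ)))

/-- The trace inner product `⟨A, B⟩ = tr (Aᵀ B)` of real `m × n` matrices. -/
def traceInner {m n : ℕ} (A B : Matrix (Fin m) (Fin n) ℝ) : ℝ :=
  (A.transpose * B).trace

/-- The vector of linear measurements `(⟨A₁, X⟩, …, ⟨A_k, X⟩)` of the matrix `X`. -/
def measurements {m n k : ℕ} (A : Fin k → Matrix (Fin m) (Fin n) ℝ)
    (X : Matrix (Fin m) (Fin n) ℝ) : Fin k → ℝ :=
  fun i => traceInner (A i) X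

/-- For given measurement matrices `A₁, …, A_k`, the map `g` is a decoder (that is, a measurable map
from `ℝᵏ` to the `m × n` matrices) that achieves error probability `ε` for the random matrix `X`. -/
def DecoderAchieves {Ω : Type*} [MeasurableSpace Ω] {m n k : ℕ} (P : Measure Ω)
    (X : Ω → Matrix (Fin m) (Fin n) ℝ) (A : Fin k → Matrix (Fin m) (Fin n) ℝ)
    (g : (Fin k → ℝ) → Matrix (Fin m) (Fin n) ℝ) (ε : ℝ) : Prop :=
  Measurable g ∧ P {ω | g (measurements A (X ω)) ≠ X ω} ≤ ENNReal.ofReal ε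

/-- The measurement matrices `A_i = a_i b_iᵀ`. -/
def rankOneMatrices {m n k : ℕ} (a : Fin k → Fin m → ℝ) (b : Fin k → Fin n → ℝ) :
    Fin k → Matrix (Fin m) (Fin n) ℝ :=
  fun i => Matrix.vecMulVec (a i) (b i)

end MatrixCompletion

namespace MatrixCompletion

open Module Set Topology

/-! Choosing `r` columns that span the rest covers the matrices of rank at most `r` by finitely many
C¹ images of spaces of dimension `m r + r (n - r) = (m + n - r) r < k`. Fix `x`. A matrix `y ≠ x` in
one such image has the same measurements as `x` only if `k` equations hold, each solvable for one
coordinate of its own measurement block. Eliminating these leaves fewer parameters than the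
dimension of measurement space, so the bad measurements are null (`measure_solvable_eq_zero`).
Fubini exchanges the quantifiers: for almost every measurement, `X` is almost surely confused with
no other low-rank matrix. Lusin–Souslin then gives a Borel inverse
(`ae_exists_measurable_recovery`). The error probability is in fact 0. -/

/-! ### Null sets by counting dimensions -/

theorem measure_image_eq_zero_of_contDiffAt {E Q : Type*}
    [NormedAddCommGroup E] [NormedSpace ℝ E] [FiniteDimensional ℝ E] [MeasurableSpace E]
    [BorelSpace E] [NormedAddCommGroup Q] [NormedSpace ℝ Q] [FiniteDimensional ℝ Q]
    (μ : Measure E) [μ.IsAddHaarMeasure] {f : Q → E} {s : Set Q}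
    (hf : ∀ x ∈ s, ContDiffAt ℝ 1 f x) (hd : finrank ℝ Q < finrank ℝ E) :
    μ (f '' s) = 0 := by
  -- C¹ maps are locally Lipschitz, so they do not raise Hausdorff dimension.
  have h1 : dimH (f '' s) ≤ dimH s := by
    refine dimH_image_le_of_locally_lipschitzOn fun x hx => ?_
    obtain ⟨K, t, ht, hK⟩ := (hf x hx).exists_lipschitzOnWith
    exact ⟨K, t, mem_nhdsWithin_of_mem_nhds ht, hK⟩
  have h2 : dimH s ≤ finrank ℝ Q := by
    rw [← Real.dimH_univ_eq_finrank Q]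
    exact dimH_mono (subset_univ s)
  have h3 : dimH (f '' s) < ((finrank ℝ E : NNReal) : ENNReal) := by
    refine (h1.trans h2).trans_lt ?_
    exact_mod_cast hd
  refine measure_zero_of_dimH_lt (d := (finrank ℝ E : NNReal)) ?_ h3
  rw [NNReal.coe_natCast]
  exact Measure.absolutelyContinuous_isAddHaarMeasure _ _

/-- Extension by zero of a vector from which the coordinate `e` has been dropped. -/
def insertZero {ι : Type*} [DecidableEq ι] (e : ι) (w : {j // j ≠ e} → ℝ) : ι → ℝ :=
  fun j => if h : j = e then 0 else w ⟨j, h⟩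

theorem contDiff_insertZero {ι : Type*} [Fintype ι] [DecidableEq ι] (e : ι) :
    ContDiff ℝ 1 (insertZero e) := by
  rw [contDiff_pi]
  intro j
  by_cases h : j = e
  · simpa only [insertZero, h, dite_true] using contDiff_const
  · simpa only [insertZero, h, dite_false] using contDiff_apply ℝ ℝ (⟨j, h⟩ : {j // j ≠ e})

theorem insertZero_restrict {ι : Type*} [DecidableEq ι] (e : ι) (v : ι → ℝ) :
    insertZero e (fun j => v j) = Function.update v e 0 := by
  ext j
  by_cases h : j = e
  · subst h; simp [insertZero]
  · simp [insertZero, h]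

/-- A system of `k` equations with fewer than `k` parameters, each of which can be solved for one
coordinate of its own block of unknowns, has a solution only for a null set of unknowns. -/
theorem measure_solvable_eq_zero {E Q ι κ : Type*} {k : ℕ}
    [NormedAddCommGroup E] [NormedSpace ℝ E] [FiniteDimensional ℝ E] [MeasurableSpace E]
    [BorelSpace E] [NormedAddCommGroup Q] [NormedSpace ℝ Q] [FiniteDimensional ℝ Q]
    [Fintype ι] [DecidableEq ι] [Finite κ]
    (μ : Measure E) [μ.IsAddHaarMeasure] (L : (Fin k → ι → ℝ) ≃ₗ[ℝ] E)
    (hd : finrank ℝ Q < k) (e : κ → ι) (α β : κ → Q → (ι → ℝ) → ℝ)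
    (hα : ∀ c, ContDiff ℝ 1 fun p : Q × (ι → ℝ) => α c p.1 p.2)
    (hβ : ∀ c, ContDiff ℝ 1 fun p : Q × (ι → ℝ) => β c p.1 p.2)
    (hα' : ∀ c y v, α c y (Function.update v (e c) 0) = α c y v)
    (hβ' : ∀ c y v, β c y (Function.update v (e c) 0) = β c y v) :
    μ {x | ∃ y, ∀ i, ∃ c, α c y (L.symm x i) ≠ 0 ∧
      L.symm x i (e c) * α c y (L.symm x i) + β c y (L.symm x i) = 0} = 0 := by
  -- `c i` selects the form of the `i`-th equation; `R c` drops the coordinate it determines and `Ψ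
  -- c` restores it as `-β / α`. There are finitely many `c`.
  let R (c : Fin k → κ) := Q × (∀ i, {j // j ≠ e (c i)} → ℝ)
  let u (c : Fin k → κ) (p : R c) (i : Fin k) : ι → ℝ := insertZero (e (c i)) (p.2 i)
  let Ψ (c : Fin k → κ) (p : R c) : Fin k → ι → ℝ := fun i =>
    u c p i + Pi.single (e (c i)) (-β (c i) p.1 (u c p i) / α (c i) p.1 (u c p i))
  let S (c : Fin k → κ) : Set (R c) := {p | ∀ i, α (c i) p.1 (u c p i) ≠ 0}
  have hu (c : Fin k → κ) (i : Fin k) : ContDiff ℝ 1 (fun p : R c => u c p i) :=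
    (contDiff_insertZero (e (c i))).comp (contDiff_pi.1 contDiff_snd i)
  have hΨ (c : Fin k → κ) : ∀ p ∈ S c, ContDiffAt ℝ 1 (L ∘ Ψ c) p := by
    intro p hp
    have hL : ContDiff ℝ 1 L := L.toContinuousLinearEquiv.contDiff
    refine hL.contDiffAt.comp p ?_
    rw [contDiffAt_pi]
    intro i
    refine (hu c i).contDiffAt.add ?_
    have h1 : ContDiffAt ℝ 1 (fun p : R c => α (c i) p.1 (u c p i)) p :=
      ((hα (c i)).comp (contDiff_fst.prodMk (hu c i))).contDiffAt
    have h2 : ContDiffAt ℝ 1 (fun p : R c => β (c i) p.1 (u c p i)) p :=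
      ((hβ (c i)).comp (contDiff_fst.prodMk (hu c i))).contDiffAt
    have h3 := h2.neg.div h1 (hp i)
    exact (LinearMap.toContinuousLinearMap
      (LinearMap.single ℝ (fun _ : ι => ℝ) (e (c i)))).contDiff.contDiffAt.comp p h3
  have hdim (c : Fin k → κ) : finrank ℝ (R c) < finrank ℝ E := by
    rw [← L.finrank_eq, finrank_prod]
    simp only [finrank_pi_fintype, finrank_self, Finset.sum_const, Finset.card_univ,
      Fintype.card_fin, smul_eq_mul, mul_one, Fintype.card_subtype_compl,
      Fintype.card_subtype_eq]
    -- For `k > 0` the index type is nonempty, so the truncated `card ι - 1` is a true difference.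
    rcases Nat.eq_zero_or_pos k with rfl | hk
    · omega
    have : 0 < Fintype.card ι := Fintype.card_pos_iff.2 ⟨e (c ⟨0, hk⟩)⟩
    obtain ⟨N, hN⟩ := Nat.exists_eq_succ_of_ne_zero this.ne'
    rw [hN]
    simp only [Nat.succ_eq_add_one, Nat.add_sub_cancel, mul_add, mul_one]
    omega
  refine measure_mono_null (t := ⋃ c : Fin k → κ, (L ∘ Ψ c) '' S c) ?_
    (measure_iUnion_null fun c => measure_image_eq_zero_of_contDiffAt μ (hΨ c) (hdim c))
  rintro x ⟨y, hy⟩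
  choose c hc using hy
  refine mem_iUnion.2 ⟨c, (y, fun i j => L.symm x i j), ?_, ?_⟩
  · intro i
    simp only [u, insertZero_restrict, hα']
    exact (hc i).1
  · rw [Function.comp_apply, ← LinearEquiv.eq_symm_apply]
    ext i j
    have h := (hc i).2
    have h0 := (hc i).1
    simp only [Ψ, u, insertZero_restrict, hα', hβ', Pi.add_apply]
    by_cases hj : j = e (c i)
    · subst hj
      simp only [Function.update_self, Pi.single_eq_same, zero_add]
      rw [div_eq_iff h0]
      linarith
    · simp [hj]

/-! ### Measurable recovery from generic separation -/

theorem measurableSet_of_isSigmaCompact {Y : Type*} [TopologicalSpace Y] [T2Space Y]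
    [MeasurableSpace Y] [BorelSpace Y] {s : Set Y} (hs : IsSigmaCompact s) : MeasurableSet s := by
  obtain ⟨K, hK, rfl⟩ := hs
  exact MeasurableSet.iUnion fun n => (hK n).measurableSet

/-- If for each fixed signal `x` almost every measurement `v` separates `x` from all other points of
a set covered by countably many continuous images, then almost every measurement determines a random
signal in that set almost surely, through a measurable map. -/
theorem ae_exists_measurable_recovery {Ω E M F κ : Type*} {Q : κ → Type*} [Countable κ]
    [MeasurableSpace Ω] (P : Measure Ω) [SFinite P]
    [TopologicalSpace E] [SigmaCompactSpace E] [T2Space E] [SecondCountableTopology E]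
    [MeasurableSpace E] [BorelSpace E]
    [TopologicalSpace M] [PolishSpace M] [SigmaCompactSpace M] [MeasurableSpace M] [BorelSpace M]
    [Nonempty M]
    [TopologicalSpace F] [T2Space F] [SecondCountableTopology F] [MeasurableSpace F] [BorelSpace F]
    [∀ c, TopologicalSpace (Q c)] [∀ c, SigmaCompactSpace (Q c)]
    (μ : Measure E) [SFinite μ] {X : Ω → M} (hX : Measurable X)
    (φ : ∀ c, Q c → M) (hφ : ∀ c, Continuous (φ c)) (hXφ : ∀ᵐ ω ∂P, ∃ c y, φ c y = X ω)
    (f : E → M → F) (hf : Continuous fun p : E × M => f p.1 p.2)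
    (hnull : ∀ x c, μ {v | ∃ y, φ c y ≠ x ∧ f v (φ c y) = f v x} = 0) :
    ∀ᵐ v ∂μ, ∃ g : F → M, Measurable g ∧ ∀ᵐ ω ∂P, g (f v (X ω)) = X ω := by
  let D : Set (E × M) := {p | ∃ c y, φ c y ≠ p.2 ∧ f p.1 (φ c y) = f p.1 p.2}
  -- The open condition `≠` is a countable union of closed ones, so `D` is a projection of σ-compact
  -- sets, hence Borel.
  have hD : MeasurableSet D := by
    let _ := TopologicalSpace.metrizableSpaceMetric M
    obtain ⟨G, hG, -, hGU, -⟩ :=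
      (isClosed_diagonal (X := M)).isOpen_compl.exists_iUnion_isClosed
    have hDe : D = ⋃ c, ⋃ n, (fun q : (E × M) × Q c => q.1) ''
        {q | (φ c q.2, q.1.2) ∈ G n ∧ f q.1.1 (φ c q.2) = f q.1.1 q.1.2} := by
      ext p
      simp only [D, mem_ofPred_eq, mem_iUnion, mem_image]
      constructor
      · rintro ⟨c, y, hne, h⟩
        have : (φ c y, p.2) ∈ ⋃ n, G n := by rw [hGU]; exact hne
        obtain ⟨n, hn⟩ := mem_iUnion.1 this
        exact ⟨c, n, (p, y), ⟨hn, h⟩, rfl⟩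
      · rintro ⟨c, n, ⟨⟨a, b⟩, y⟩, ⟨hn, h⟩, rfl⟩
        have : (φ c y, b) ∈ ⋃ n, G n := mem_iUnion.2 ⟨n, hn⟩
        rw [hGU] at this
        exact ⟨c, y, this, h⟩
    rw [hDe]
    refine MeasurableSet.iUnion fun c => MeasurableSet.iUnion fun n => measurableSet_of_isSigmaCompact ?_
    have hc := hφ c
    refine IsSigmaCompact.image continuous_fst
      (isSigmaCompact_univ.of_isClosed_subset ?_ (subset_univ _))
    refine IsClosed.inter ((hG n).preimage (f := fun q : (E × M) × Q c => (φ c q.2, q.1.2))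
      (by fun_prop)) ?_
    exact isClosed_eq
      (hf.comp (f := fun q : (E × M) × Q c => (q.1.1, φ c q.2)) (by fun_prop))
      (hf.comp (f := fun q : (E × M) × Q c => q.1) (by fun_prop))
  let U : Set M := ⋃ c, range (φ c)
  have hU : MeasurableSet U :=
    MeasurableSet.iUnion fun c => measurableSet_of_isSigmaCompact (isSigmaCompact_range (hφ c))
  have hD0 : (P.map X).prod μ (Prod.swap ⁻¹' D) = 0 := by
    rw [Measure.measure_prod_null (measurable_swap hD)]
    refine Filter.Eventually.of_forall fun x => ?_
    refine measure_mono_null (t := ⋃ c, {v | ∃ y, φ c y ≠ x ∧ f v (φ c y) = f v x}) ?_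
      (measure_iUnion_null fun c => hnull x c)
    rintro v ⟨c, y, h⟩
    exact mem_iUnion.2 ⟨c, y, h⟩
  have hD1 : μ.prod (P.map X) D = 0 := by
    rw [← Measure.prod_swap, Measure.map_apply measurable_swap hD]
    exact hD0
  filter_upwards [(Measure.measure_prod_null hD).1 hD1] with v hv
  have hDv : MeasurableSet (Prod.mk v ⁻¹' D) := measurable_prodMk_left hD
  have hfv : Continuous (f v) := hf.comp (f := fun x => (v, x)) (by fun_prop)
  have hS : MeasurableSet (U \ Prod.mk v ⁻¹' D) := hU.diff hDv
  -- A collision is excluded as soon as one of the two points lies outside the slice of `D` and the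
  -- other lies in `U`.
  have hinj : InjOn (f v) (U \ Prod.mk v ⁻¹' D) := by
    rintro x ⟨hxU, -⟩ x' ⟨-, hx'⟩ hxx'
    obtain ⟨c, y, rfl⟩ := mem_iUnion.1 hxU
    by_contra hne
    exact hx' ⟨c, y, hne, hxx'⟩
  -- Lusin–Souslin: a continuous injection on a Borel set is a measurable embedding.
  have hemb := hfv.continuousOn.measurableEmbedding hS hinj
  obtain ⟨g, hg, hgf⟩ := hemb.exists_measurable_extend measurable_subtype_coe
    (fun _ => inferInstance)
  refine ⟨g, hg, ?_⟩
  have hv' : ∀ᵐ ω ∂P, X ω ∉ Prod.mk v ⁻¹' D := by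
    have : P.map X (Prod.mk v ⁻¹' D) = 0 := hv
    rw [Measure.map_apply hX hDv] at this
    exact measure_eq_zero_iff_ae_notMem.1 this
  filter_upwards [hXφ, hv'] with ω hω1 hω2
  obtain ⟨c, y, hy⟩ := hω1
  exact congrFun hgf ⟨X ω, mem_iUnion.2 ⟨c, y, hy⟩, hω2⟩

/-! ### Parametrizing matrices of low rank -/

/-- Parameters of the `m × n` matrices whose columns are combinations of the columns in `J`. -/
abbrev ColumnParam (m : ℕ) {n : ℕ} (J : Finset (Fin n)) : Type :=
  (Fin m → {j // j ∈ J} → ℝ) × ({j // j ∈ J} → {j // j ∉ J} → ℝ)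

/-- The matrix with prescribed columns in `J`, and with the other columns the prescribed
combinations of these. -/
def columnMatrix {m n : ℕ} (J : Finset (Fin n)) (q : ColumnParam m J) :
    Matrix (Fin m) (Fin n) ℝ :=
  fun s t => if h : t ∈ J then q.1 s ⟨t, h⟩ else ∑ j, q.1 s j * q.2 j ⟨t, h⟩

theorem contDiff_columnMatrix_apply {m n : ℕ} (J : Finset (Fin n)) (s : Fin m) (t : Fin n) :
    ContDiff ℝ 1 fun q : ColumnParam m J => columnMatrix J q s t := by
  by_cases h : t ∈ J
  · simp only [columnMatrix, h, dite_true]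
    fun_prop
  · simp only [columnMatrix, h, dite_false]
    fun_prop

theorem continuous_columnMatrix {m n : ℕ} (J : Finset (Fin n)) :
    Continuous (columnMatrix (m := m) J) :=
  continuous_matrix fun s t => (contDiff_columnMatrix_apply J s t).continuous

theorem finrank_columnParam {m n : ℕ} (J : Finset (Fin n)) :
    finrank ℝ (ColumnParam m J) = m * J.card + J.card * (n - J.card) := by
  simp only [ColumnParam, finrank_prod, finrank_pi_fintype, finrank_self, Finset.sum_const,
    Finset.card_univ, Fintype.card_fin, smul_eq_mul, mul_one, Fintype.card_coe,
    Fintype.card_subtype_compl]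

/-- A basis of the column space taken among the columns has at most `r` members; padding it to
exactly `r` fixes the number of parameters. -/
theorem exists_columnMatrix_eq {m n r : ℕ} (hr : r ≤ n) (Y : Matrix (Fin m) (Fin n) ℝ)
    (hY : Y.rank ≤ r) :
    ∃ (J : {J : Finset (Fin n) // J.card = r}) (q : ColumnParam m J.1), columnMatrix J.1 q = Y := by
  classical
  obtain ⟨b, -, -, hspan, hb⟩ := exists_linearIndepOn_extension (K := ℝ) (v := Y.col)
    (linearIndepOn_empty ℝ Y.col) (subset_univ ∅)
  have hcard : b.toFinset.card ≤ r := by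
    refine le_trans ?_ hY
    rw [Matrix.rank_eq_finrank_span_cols, Set.toFinset_card, ← finrank_span_eq_card hb]
    refine Submodule.finrank_mono (Submodule.span_mono ?_)
    rintro _ ⟨j, rfl⟩
    exact ⟨j, rfl⟩
  obtain ⟨J, hbJ, -, hJ⟩ := Finset.exists_subsuperset_card_eq (Finset.subset_univ b.toFinset)
    hcard (by simpa using hr)
  have hcomb (t : {j // j ∉ J}) : ∃ c : {j // j ∈ J} → ℝ, ∑ j, c j • Y.col j = Y.col t := by
    rw [← Submodule.mem_span_range_iff_exists_fun]
    refine Submodule.span_mono ?_ (hspan ⟨t, mem_univ _, rfl⟩)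
    rintro _ ⟨j, hj, rfl⟩
    exact ⟨⟨j, hbJ (Set.mem_toFinset.2 hj)⟩, rfl⟩
  choose c hc using hcomb
  refine ⟨⟨J, hJ⟩, (fun s j => Y s j, fun j t => c t j), ?_⟩
  ext s t
  by_cases h : t ∈ J
  · simp [columnMatrix, h]
  · have := congrFun (hc ⟨t, h⟩) s
    simp only [Finset.sum_apply, Pi.smul_apply, smul_eq_mul, Matrix.col_apply] at this
    simp only [columnMatrix, h, dite_false, ← this, mul_comm]

/-! ### Generic and rank-one measurements -/

theorem traceInner_eq_sum {m n : ℕ} (A B : Matrix (Fin m) (Fin n) ℝ) :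
    traceInner A B = ∑ s, ∑ t, A s t * B s t := by
  rw [traceInner, Matrix.trace, Finset.sum_comm]
  simp [Matrix.mul_apply]

theorem traceInner_sub {m n : ℕ} (A B C : Matrix (Fin m) (Fin n) ℝ) :
    traceInner A (B - C) = traceInner A B - traceInner A C := by
  simp [traceInner, Matrix.mul_sub]

theorem traceInner_vecMulVec {m n : ℕ} (a : Fin m → ℝ) (b : Fin n → ℝ)
    (B : Matrix (Fin m) (Fin n) ℝ) :
    traceInner (Matrix.vecMulVec a b) B = ∑ s, a s * ∑ t, B s t * b t := by
  simp only [traceInner_eq_sum, Matrix.vecMulVec_apply, Finset.mul_sum]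
  exact Finset.sum_congr rfl fun s _ => Finset.sum_congr rfl fun t _ => by ring

theorem exists_apply_ne_zero {m n : ℕ} {Y : Matrix (Fin m) (Fin n) ℝ} (hY : Y ≠ 0) :
    ∃ s t, Y s t ≠ 0 := by
  by_contra! h
  exact hY (Matrix.ext h)

instance isAddHaarMeasure_volume_pi_pi (k m : ℕ) :
    (volume : Measure (Fin k → Fin m → ℝ)).IsAddHaarMeasure :=
  Measure.pi.isAddHaarMeasure _

instance isAddHaarMeasure_volume_pi_pi_pi (k m n : ℕ) :
    (volume : Measure (Fin k → Fin m → Fin n → ℝ)).IsAddHaarMeasure :=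
  Measure.pi.isAddHaarMeasure _

instance isAddHaarMeasure_volume_pi_pi_prod (k m n : ℕ) :
    (volume : Measure ((Fin k → Fin m → ℝ) × (Fin k → Fin n → ℝ))).IsAddHaarMeasure :=
  Measure.prod.instIsAddHaarMeasure _ _

/-- At a nonzero entry `(s, t)` of `Z q`, each equation can be solved for the `(s, t)` entry of `A
i`. -/
theorem volume_measurements_eq_zero {m n k : ℕ} {Q : Type*} [NormedAddCommGroup Q]
    [NormedSpace ℝ Q] [FiniteDimensional ℝ Q] (hd : finrank ℝ Q < k)
    (Z : Q → Matrix (Fin m) (Fin n) ℝ) (hZ : ∀ s t, ContDiff ℝ 1 fun q => Z q s t) :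
    volume {A : Fin k → Matrix (Fin m) (Fin n) ℝ | ∃ q, Z q ≠ 0 ∧ ∀ i, traceInner (A i) (Z q) = 0}
      = 0 := by
  let L : (Fin k → Fin m × Fin n → ℝ) ≃ₗ[ℝ] (Fin k → Fin m → Fin n → ℝ) :=
    LinearEquiv.piCongrRight fun _ => LinearEquiv.curry ℝ ℝ (Fin m) (Fin n)
  have key := measure_solvable_eq_zero (volume : Measure (Fin k → Fin m → Fin n → ℝ)) L hd
    (id : Fin m × Fin n → Fin m × Fin n) (fun c q _ => Z q c.1 c.2)
    (fun c q v => ∑ p ∈ Finset.univ.erase c, v p * Z q p.1 p.2)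
    (fun c => (hZ c.1 c.2).comp contDiff_fst)
    (fun c => ContDiff.sum fun p _ =>
      (by fun_prop : ContDiff ℝ 1 fun x : Q × (Fin m × Fin n → ℝ) => x.2 p).mul
        ((hZ p.1 p.2).comp contDiff_fst))
    (fun _ _ _ => rfl)
    (fun c q v => Finset.sum_congr rfl fun p hp => by
      simp [Function.update_of_ne (Finset.ne_of_mem_erase hp)])
  refine measure_mono_null ?_ key
  rintro A ⟨q, hq, hA⟩
  obtain ⟨s, t, hst⟩ := exists_apply_ne_zero hq
  refine ⟨q, fun i => ⟨(s, t), hst, ?_⟩⟩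
  have h := hA i
  rw [traceInner_eq_sum, ← Fintype.sum_prod_type',
    ← Finset.add_sum_erase _ _ (Finset.mem_univ (s, t))] at h
  exact h

/-- The equation is `aᵀ Z b = 0`. If `(Z b)_s ≠ 0`, solve it for `a_s` (case `inl s`). If `Z b = 0`,
take `Z_st ≠ 0` and solve `(Z b)_s = 0` for `b_t` (case `inr (s, t)`). -/
theorem volume_rankOne_measurements_eq_zero {m n k : ℕ} {Q : Type*} [NormedAddCommGroup Q]
    [NormedSpace ℝ Q] [FiniteDimensional ℝ Q] (hd : finrank ℝ Q < k)
    (Z : Q → Matrix (Fin m) (Fin n) ℝ) (hZ : ∀ s t, ContDiff ℝ 1 fun q => Z q s t) :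
    volume {p : (Fin k → Fin m → ℝ) × (Fin k → Fin n → ℝ) | ∃ q, Z q ≠ 0 ∧
      ∀ i, traceInner (rankOneMatrices p.1 p.2 i) (Z q) = 0} = 0 := by
  let L : (Fin k → Fin m ⊕ Fin n → ℝ) ≃ₗ[ℝ] (Fin k → Fin m → ℝ) × (Fin k → Fin n → ℝ) :=
    { toFun := fun w => (fun i s => w i (Sum.inl s), fun i t => w i (Sum.inr t))
      invFun := fun x i => Sum.elim (x.1 i) (x.2 i)
      map_add' := fun _ _ => rfl
      map_smul' := fun _ _ => rfl
      left_inv := fun w => by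
        ext i (s | t) <;> rfl
      right_inv := fun _ => rfl }
  let α : Fin m ⊕ (Fin m × Fin n) → Q → (Fin m ⊕ Fin n → ℝ) → ℝ := fun c q v =>
    Sum.elim (fun s => ∑ t, Z q s t * v (Sum.inr t)) (fun p => Z q p.1 p.2) c
  let β : Fin m ⊕ (Fin m × Fin n) → Q → (Fin m ⊕ Fin n → ℝ) → ℝ := fun c q v =>
    Sum.elim
      (fun s => ∑ s' ∈ Finset.univ.erase s,
        v (Sum.inl s') * ∑ t, Z q s' t * v (Sum.inr t))
      (fun p => ∑ t ∈ Finset.univ.erase p.2, Z q p.1 t * v (Sum.inr t)) c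
  have hZ' (s : Fin m) (t : Fin n) :
      ContDiff ℝ 1 fun x : Q × (Fin m ⊕ Fin n → ℝ) => Z x.1 s t := (hZ s t).comp contDiff_fst
  have hv (j : Fin m ⊕ Fin n) : ContDiff ℝ 1 fun x : Q × (Fin m ⊕ Fin n → ℝ) => x.2 j := by
    fun_prop
  have hZv (s : Fin m) : ContDiff ℝ 1
      fun x : Q × (Fin m ⊕ Fin n → ℝ) => ∑ t, Z x.1 s t * x.2 (Sum.inr t) :=
    ContDiff.sum fun t _ => (hZ' s t).mul (hv _)
  have key := measure_solvable_eq_zero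
    (volume : Measure ((Fin k → Fin m → ℝ) × (Fin k → Fin n → ℝ))) L hd
    (Sum.map id Prod.snd) α β
    (by rintro (s | p); exacts [hZv s, hZ' p.1 p.2])
    (by
      rintro (s | p)
      · exact ContDiff.sum fun s' _ => (hv _).mul (hZv s')
      · exact ContDiff.sum fun t _ => (hZ' p.1 t).mul (hv _))
    (by rintro (s | p) q v <;> simp [α])
    (by
      rintro (s | p) q v
      · refine Finset.sum_congr rfl fun s' hs' => ?_
        simp [Finset.ne_of_mem_erase hs']
      · refine Finset.sum_congr rfl fun t ht => ?_
        simp [Finset.ne_of_mem_erase ht])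
  refine measure_mono_null ?_ key
  rintro x ⟨q, hq, hx⟩
  refine ⟨q, fun i => ?_⟩
  by_cases h : ∃ s, ∑ t, Z q s t * x.2 i t ≠ 0
  · obtain ⟨s, hs⟩ := h
    refine ⟨Sum.inl s, hs, ?_⟩
    have := hx i
    rw [rankOneMatrices, traceInner_vecMulVec,
      ← Finset.add_sum_erase _ _ (Finset.mem_univ s)] at this
    exact this
  · push Not at h
    obtain ⟨s, t, hst⟩ := exists_apply_ne_zero hq
    refine ⟨Sum.inr (s, t), hst, ?_⟩
    have := h s
    rw [← Finset.add_sum_erase _ _ (Finset.mem_univ t), mul_comm (Z q s t)] at this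
    exact this

/-! ### Decoders -/

theorem ae_exists_decoder {Ω E : Type*} [MeasurableSpace Ω] (P : Measure Ω) [SFinite P]
    [TopologicalSpace E] [SigmaCompactSpace E] [T2Space E] [SecondCountableTopology E]
    [MeasurableSpace E] [BorelSpace E] (μ : Measure E) [SFinite μ]
    {m n r k : ℕ} (hr : r ≤ n) (hk : m * r + r * (n - r) < k)
    {X : Ω → Matrix (Fin m) (Fin n) ℝ} (hX : Measurable X) (hrank : ∀ᵐ ω ∂P, (X ω).rank ≤ r)
    (A : E → Fin k → Matrix (Fin m) (Fin n) ℝ) (hA : Continuous A)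
    (hnull : ∀ J : Finset (Fin n), finrank ℝ (ColumnParam m J) < k →
      ∀ Z : ColumnParam m J → Matrix (Fin m) (Fin n) ℝ,
        (∀ s t, ContDiff ℝ 1 fun q => Z q s t) →
        μ {v | ∃ q, Z q ≠ 0 ∧ ∀ i, traceInner (A v i) (Z q) = 0} = 0) (ε : ℝ) :
    ∀ᵐ v ∂μ, ∃ g, DecoderAchieves P X (A v) g ε := by
  have : PolishSpace (Matrix (Fin m) (Fin n) ℝ) :=
    inferInstanceAs (PolishSpace (Fin m → Fin n → ℝ))
  have : SigmaCompactSpace (Matrix (Fin m) (Fin n) ℝ) :=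
    inferInstanceAs (SigmaCompactSpace (Fin m → Fin n → ℝ))
  have key := ae_exists_measurable_recovery P μ hX
    (fun J : {J : Finset (Fin n) // J.card = r} => columnMatrix (m := m) J.1)
    (fun J => continuous_columnMatrix J.1)
    (hrank.mono fun ω hω => exists_columnMatrix_eq hr (X ω) hω)
    (fun v Y => measurements (A v) Y)
    (by
      refine continuous_pi fun i => ?_
      have : Continuous fun p : E × Matrix (Fin m) (Fin n) ℝ => A p.1 i :=
        (continuous_apply i).comp (hA.comp continuous_fst)
      exact (this.matrix_transpose.matrix_mul continuous_snd).matrix_trace)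
    (fun x J => by
      -- By linearity, confusing `x` with `y` means that `y - x` has zero measurements; the shift by
      -- `x` costs no parameters.
      refine measure_mono_null ?_ (hnull J.1 (by rw [finrank_columnParam, J.2]; exact hk)
        (fun q => columnMatrix J.1 q - x)
        (fun s t => (contDiff_columnMatrix_apply J.1 s t).sub contDiff_const))
      rintro v ⟨q, hq, h⟩
      refine ⟨q, sub_ne_zero.2 hq, fun i => ?_⟩
      rw [traceInner_sub, sub_eq_zero]
      exact congrFun h i)
  filter_upwards [key] with v hv
  obtain ⟨g, hg, hgX⟩ := hv
  refine ⟨g, hg, ?_⟩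
  rw [show P {ω | g (measurements (A v) (X ω)) ≠ X ω} = 0 from hgX]
  exact zero_le

end MatrixCompletion

theorem mainTheorem4 {Ω : Type*} [MeasurableSpace Ω] (P : Measure Ω) [IsProbabilityMeasure P]
    (m n r k : ℕ) (hr : r ≤ min m n)
    (X : Ω → Matrix (Fin m) (Fin n) ℝ) (hX : Measurable X) (hrank : ∀ᵐ ω ∂P, (X ω).rank ≤ r)
    (ε : ℝ) (hε : 0 < ε) (hk : ((m : ℤ) + (n : ℤ) - (r : ℤ)) * (r : ℤ) < (k : ℤ)) :
    (∀ᵐ A : Fin k → Matrix (Fin m) (Fin n) ℝ,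
      ∃ g : (Fin k → ℝ) → Matrix (Fin m) (Fin n) ℝ,
        MatrixCompletion.DecoderAchieves P X A g ε) ∧
    (∀ᵐ p : (Fin k → Fin m → ℝ) × (Fin k → Fin n → ℝ),
      ∃ g : (Fin k → ℝ) → Matrix (Fin m) (Fin n) ℝ,
        MatrixCompletion.DecoderAchieves P X (MatrixCompletion.rankOneMatrices p.1 p.2) g ε) := by
  have hrn : r ≤ n := hr.trans (min_le_right m n)
  have hk' : m * r + r * (n - r) < k := by
    zify [hrn]
    linarith
  constructor
  · have : SigmaCompactSpace (Matrix (Fin m) (Fin n) ℝ) :=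
      inferInstanceAs (SigmaCompactSpace (Fin m → Fin n → ℝ))
    have : SecondCountableTopology (Matrix (Fin m) (Fin n) ℝ) :=
      inferInstanceAs (SecondCountableTopology (Fin m → Fin n → ℝ))
    exact MatrixCompletion.ae_exists_decoder P volume hrn hk' hX hrank (fun A => A) continuous_id
      (fun J hJ Z hZ => MatrixCompletion.volume_measurements_eq_zero hJ Z hZ) ε
  · refine MatrixCompletion.ae_exists_decoder P volume hrn hk' hX hrank
      (fun p : (Fin k → Fin m → ℝ) × (Fin k → Fin n → ℝ) =>
        MatrixCompletion.rankOneMatrices p.1 p.2) ?_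
      (fun J hJ Z hZ => MatrixCompletion.volume_rankOne_measurements_eq_zero hJ Z hZ) ε
    refine continuous_pi fun i => continuous_matrix fun s t => ?_
    simp only [MatrixCompletion.rankOneMatrices, Matrix.vecMulVec_apply]
    fun_prop
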